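/- Let $f:\mathbb{C}\to\mathbb{C}$ be a transcendental entire function with $f(\mathbb{R})\subset\mathbb{R}$ whose set $S(f)$ of singular values is bounded. Here $S(f)$ is the smallest closed set $S\subset\mathbb{C}$ such that $f:\mathbb{C}\setminus f^{-1}(S)\to\mathbb{C}\setminus S$ is a covering map. Let $\sigma\in\{+1,-1\}$ be such that $|f(\sigma x)|\to\infty$ as $x\to+\infty$ (that is, $\sigma\in\Sigma_0(f)$). For $\theta>0$ and $R>0$ define the truncated sector \[ S_{\sigma,\theta,R}:=\{\sigma x+iy : x,y\in\mathbb{R},\ x>R,\ |y|<\theta x\}. \] Then the following statements are equivalent: (i) $f$ satisfies the sector condition at $\sigma\infty$: for all sufficiently large $R>0$ there are $\theta>0$ and $R'>0$ such that $|f(\sigma x+iy)|>R$ for all real $x,y$ with $x>R'$ and $|y|<\theta x$. (ii) For every compact set $K\subset\mathbb{C}$ there are $\theta>0$ and $R>0$ such that $f^{-1}(K)\cap S_{\sigma,\theta,R}=\emptyset$. (iii) There exist a point $w$ in the unbounded connected component of $\mathbb{C}\setminus S(f)$ and $\theta'>0$, $R'>0$ such that $f^{-1}(w)\cap S_{\sigma,\theta',R'}=\emptyset$.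 -/

import Mathlib

open Filter

/-- The set `S(f)` of (finite) singular values of `f`: the smallest closed set `S ⊆ ℂ` such that
`f : ℂ \ f⁻¹(S) → ℂ \ S` is a covering map (see `isLeast_singularValues`). -/
def singularValues (f : ℂ → ℂ) : Set ℂ :=
  ⋂₀ {S : Set ℂ | IsClosed S ∧ IsCoveringMapOn f Sᶜ}

/-- The intersection in the definition of `S(f)` is indeed attained: a smallest set exists. -/
theorem isLeast_singularValues (f : ℂ → ℂ) :
    IsLeast {S : Set ℂ | IsClosed S ∧ IsCoveringMapOn f Sᶜ} (singularValues f) := by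
  refine ⟨⟨isClosed_sInter fun S hS => hS.1, ?_⟩, fun S hS => Set.sInter_subset_of_mem hS⟩
  intro x hx
  have hx' : ∃ S : Set ℂ, (IsClosed S ∧ IsCoveringMapOn f Sᶜ) ∧ x ∉ S := by
    by_contra h
    push Not at h
    exact hx (Set.mem_sInter.2 fun S hS => h S hS)
  obtain ⟨S, hS, hxS⟩ := hx'
  exact hS.2 x hxS

/-- The class of real transcendental entire functions with bounded set of singular values. -/
structure IsRealClassB (f : ℂ → ℂ) : Prop where
  entire : Differentiable ℂ f
  transcendental : ¬ ∃ p : Polynomial ℂ, ∀ z, f z = p.eval z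
  real : ∀ x : ℝ, ∃ y : ℝ, f x = y
  bounded : Bornology.IsBounded (singularValues f)

/-- The set `Σ₀(f)` of signs `σ` (encoded as the real numbers `1` and `-1`) for which
`|f(σ x)| → ∞` as `x → +∞`. -/
def escapingSigns (f : ℂ → ℂ) : Set ℝ :=
  {σ | (σ = 1 ∨ σ = -1) ∧ Tendsto (fun x : ℝ => ‖f ((σ * x : ℝ) : ℂ)‖) atTop atTop}

/-- The truncated sector `{σ x + i y : x > R, |y| < θ x}`. -/
def truncatedSector (σ θ R : ℝ) : Set ℂ :=
  {z | ∃ x y : ℝ, R < x ∧ |y| < θ * x ∧ z = ((σ * x : ℝ) : ℂ) + Complex.I * (y : ℂ)}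

/-- The real sector condition at `σ∞`. -/
def SectorCondition (f : ℂ → ℂ) (σ : ℝ) : Prop :=
  ∀ᶠ R : ℝ in atTop, ∃ θ > (0 : ℝ), ∃ R' > (0 : ℝ), ∀ x y : ℝ, R' < x → |y| < θ * x →
    R < ‖f (((σ * x : ℝ) : ℂ) + Complex.I * (y : ℂ))‖

/-- The set `A` omits (i.e. is disjoint from) some truncated sector in the direction `σ`. -/
def OmitsTruncatedSector (A : Set ℂ) (σ : ℝ) : Prop :=
  ∃ θ > (0 : ℝ), ∃ R > (0 : ℝ), Disjoint A (truncatedSector σ θ R)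

/-- The unbounded part of `ℂ \ S`: the union of the unbounded connected components of `ℂ \ S`.
If `S` is bounded there is exactly one such component. -/
def unboundedComponent (S : Set ℂ) : Set ℂ :=
  {w | w ∈ Sᶜ ∧ ¬ Bornology.IsBounded (connectedComponentIn Sᶜ w)}

/-! Only (iii) ⇒ (i) has content. Over a disc about a nonsingular `w`, all inverse branches `φ` of
`f` are univalent and omit a common point `a`. A logarithm of `φ - a` cannot take two values
differing by `2πi`, so its image contains no disc of radius 7, and Bloch's theorem bounds its
derivative uniformly over all branches. Hence if `f z` is close to `w`, some preimage of `w` lies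
within a small multiple of `|z - a|` of `z` (`exists_preimage_near_of_isEvenlyCovered`). If a sector
omits `w`, a narrower one therefore omits a whole disc about `w` (`exists_sector_omitting_ball`).

There `g = 1/(f - w)` is bounded, and it tends to 0 along the real ray. A maximum principle for a
product of four rotated copies of `g` (`norm_pow_four_le_of_bound_on_square`) carries this decay to
a smaller sector, so `f → ∞` there. -/

/-! ### Inverse branches over an evenly covered disc -/

theorem exists_holomorphic_section_of_isEvenlyCovered {f : ℂ → ℂ} (hf : Differentiable ℂ f)
    (hconst : ¬ ∃ c, ∀ z, f z = c) {w : ℂ} {I : Type*} [TopologicalSpace I]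
    (hw : IsEvenlyCovered f w I) :
    ∃ δ > 0, ∀ z, f z ∈ Metric.ball w δ → ∃ φ : ℂ → ℂ,
      DifferentiableOn ℂ φ (Metric.ball w δ) ∧ φ (f z) = z ∧
        ∀ v ∈ Metric.ball w δ, f (φ v) = v := by
  classical
  obtain ⟨-, U, hwU, hU, -, H, hH⟩ := hw
  obtain ⟨δ, hδ, hδU⟩ := Metric.isOpen_iff.1 hU w hwU
  refine ⟨δ, hδ, fun z hz => ?_⟩
  let i := (H ⟨z, hδU hz⟩).2
  let φ : ℂ → ℂ := fun v => if h : v ∈ U then (H.symm (⟨v, h⟩, i)).1 else 0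
  have hφ : ∀ v (h : v ∈ U), φ v = (H.symm (⟨v, h⟩, i)).1 := fun v h => dif_pos h
  have hfφ : ∀ v ∈ U, f (φ v) = v := by
    intro v h
    rw [hφ v h, ← hH, H.apply_symm_apply]
  have hcont : ContinuousOn φ U := by
    rw [continuousOn_iff_continuous_domRestrict]
    have : U.domRestrict φ = fun v : U => (H.symm (v, i)).1 := by
      funext v
      exact hφ v v.2
    rw [this]
    fun_prop
  refine ⟨φ, ?_, ?_, fun v hv => hfφ v (hδU hv)⟩
  · intro v₀ hv₀
    have hv₀U := hδU hv₀
    have hUv := hU.mem_nhds hv₀U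
    have hca : ContinuousAt φ v₀ := hcont.continuousAt hUv
    -- Zeros of `deriv f` are isolated and `φ` is injective, so near `v₀` the inverse function rule
    -- applies off `v₀`; continuity makes `v₀` removable.
    refine (Complex.analyticAt_of_differentiable_on_punctured_nhds_of_continuousAt ?_
      hca).differentiableAt.differentiableWithinAt
    have hderiv : ∀ᶠ x in nhdsWithin (φ v₀) {φ v₀}ᶜ, deriv f x ≠ 0 := by
      have hd : AnalyticOnNhd ℂ (deriv f) Set.univ := fun x _ => (hf.analyticAt x).deriv
      refine ((hd _ (Set.mem_univ _)).eventually_eq_zero_or_eventually_ne_zero).resolve_left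
        fun h0 => hconst ⟨f 0, fun x => ?_⟩
      have h1 := hd.eqOn_zero_of_preconnected_of_eventuallyEq_zero isPreconnected_univ
        (Set.mem_univ _) h0
      exact is_const_of_deriv_eq_zero hf (fun y => h1 (Set.mem_univ y)) x 0
    have htend : Tendsto φ (nhdsWithin v₀ {v₀}ᶜ) (nhdsWithin (φ v₀) {φ v₀}ᶜ) := by
      refine tendsto_nhdsWithin_iff.2 ⟨hca.mono_left nhdsWithin_le_nhds, ?_⟩
      filter_upwards [self_mem_nhdsWithin, mem_nhdsWithin_of_mem_nhds hUv] with x hx hxU hxe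
      have : φ x = φ v₀ := hxe
      exact hx (by rw [Set.mem_singleton_iff, ← hfφ x hxU, this, hfφ _ hv₀U])
    filter_upwards [htend.eventually hderiv, mem_nhdsWithin_of_mem_nhds hUv] with x hx hxU
    exact (HasDerivAt.of_local_left_inverse (hcont.continuousAt (hU.mem_nhds hxU))
      (hf (φ x)).hasDerivAt hx
      (by filter_upwards [hU.mem_nhds hxU] with y hy using hfφ y hy)).differentiableAt
  · rw [hφ _ (hδU hz)]
    have : ((⟨f z, hδU hz⟩ : U), i) = H ⟨z, hδU hz⟩ := 
      Prod.ext (Subtype.ext (hH ⟨z, hδU hz⟩).symm) rfl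
    rw [this, H.symm_apply_apply]

/-! ### Bloch's theorem -/

/-- A local form of Bloch's theorem at a point where the derivative is nearly maximal. -/
theorem ball_subset_image_ball_of_norm_deriv_le {L : ℂ → ℂ} {p : ℂ} {s : ℝ} (hs : 0 < s)
    (hL : DifferentiableOn ℂ L (Metric.ball p s)) (h0 : deriv L p ≠ 0)
    (hle : ∀ v ∈ Metric.ball p s, ‖deriv L v‖ ≤ 2 * ‖deriv L p‖) :
    Metric.ball (L p) (‖deriv L p‖ * s / 24) ⊆ L '' Metric.ball p s := by
  set A := ‖deriv L p‖ with hA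
  have hApos : 0 < A := norm_pos_iff.2 h0
  have hsub : Metric.closedBall p (s / 6) ⊆ Metric.ball p s :=
    Metric.closedBall_subset_ball (by linarith)
  have hdL : DifferentiableOn ℂ (deriv L) (Metric.ball p s) := hL.deriv Metric.isOpen_ball
  -- Schwarz lemma for `deriv L - deriv L p`, which is at most `3 * A` on the ball of radius `s`.
  have hschwarz : ∀ v ∈ Metric.closedBall p (s / 6), ‖deriv L v - deriv L p‖ ≤ A / 2 := by
    intro v hv
    have := Complex.dist_le_div_mul_dist_of_mapsTo_ball (R₂ := 3 * A) hdL (fun u hu => by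
      rw [mem_closedBall_iff_norm]
      linarith [norm_sub_le (deriv L u) (deriv L p), hle u hu]) (hsub hv)
    rw [dist_eq_norm] at this
    refine this.trans ?_
    calc 3 * A / s * dist v p ≤ 3 * A / s * (s / 6) := by
          gcongr
          exact hv
      _ = A / 2 := by field_simp; norm_num
  -- The linear part has size `A * s / 6`; the remainder is at most half of that.
  have hlow : ∀ v ∈ Metric.sphere p (s / 6), A * s / 12 ≤ ‖L v - L p‖ := by
    intro v hv
    have hvn : ‖v - p‖ = s / 6 := by simpa [dist_eq_norm] using hv
    have hmv := (convex_closedBall p (s / 6)).norm_image_sub_le_of_norm_hasDerivWithin_le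
      (f := fun u => L u - deriv L p * u) (f' := fun u => deriv L u - deriv L p) (C := A / 2)
      (x := p) (y := v)
      (fun u hu => by
        have h1 := (hL.differentiableAt (Metric.isOpen_ball.mem_nhds (hsub hu))).hasDerivAt
        have h2 : HasDerivAt (fun u => deriv L p * u) (deriv L p) u := by
          simpa using (hasDerivAt_id u).const_mul (deriv L p)
        exact (h1.sub h2).hasDerivWithinAt)
      hschwarz (Metric.mem_closedBall_self (by positivity)) (Metric.sphere_subset_closedBall hv)
    have h1 : ‖deriv L p * (v - p)‖ = A * (s / 6) := by rw [norm_mul, hvn]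
    have h2 : deriv L p * (v - p) =
        (L v - L p) - (L v - deriv L p * v - (L p - deriv L p * p)) := by ring
    have h3 := norm_sub_le (L v - L p) (L v - deriv L p * v - (L p - deriv L p * p))
    rw [← h2, h1] at h3
    rw [hvn] at hmv
    linarith
  have hdc : DiffContOnCl ℂ L (Metric.ball p (s / 6)) :=
    (hL.mono (closure_minimal (Metric.ball_subset_closedBall.trans subset_rfl)
      Metric.isClosed_closedBall |>.trans hsub)).diffContOnCl
  have hfreq : ∃ᶠ v in nhds p, L v ≠ L p := by
    intro hev
    have : L =ᶠ[nhds p] fun _ => L p := by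
      filter_upwards [hev] with v hv using not_not.1 hv
    exact h0 (by rw [this.deriv_eq, deriv_const])
  have := hdc.ball_subset_image_closedBall (by positivity) hlow hfreq
  have he : A * s / 12 / 2 = A * s / 24 := by ring
  rw [he] at this
  exact this.trans (Set.image_mono hsub)

/-- A form of Bloch's theorem. -/
theorem norm_deriv_le_of_not_ball_subset_image {L : ℂ → ℂ} {c : ℂ} {r ρ : ℝ} (hr : 0 < r)
    (hρ : 0 < ρ) (hL : DifferentiableOn ℂ L (Metric.ball c r))
    (himg : ∀ q, ¬ Metric.ball q ρ ⊆ L '' Metric.ball c r) :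
    ‖deriv L c‖ ≤ 96 * ρ / r := by
  have hsub : Metric.closedBall c (r / 2) ⊆ Metric.ball c r :=
    Metric.closedBall_subset_ball (by linarith)
  have hdL : DifferentiableOn ℂ (deriv L) (Metric.ball c r) := hL.deriv Metric.isOpen_ball
  -- Landau's weight: within half the distance from its maximum point `p` to the boundary, `‖deriv
  -- L‖` at most doubles.
  have hcont : ContinuousOn (fun v => ‖deriv L v‖ * (r / 2 - dist v c))
      (Metric.closedBall c (r / 2)) :=
    (hdL.continuousOn.mono hsub).norm.mul (by fun_prop)
  obtain ⟨p, hp, hmax⟩ := (isCompact_closedBall c (r / 2)).exists_isMaxOn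
    ⟨c, Metric.mem_closedBall_self (by positivity)⟩ hcont
  have hmax' : ∀ v ∈ Metric.closedBall c (r / 2),
    ‖deriv L v‖ * (r / 2 - dist v c) ≤ ‖deriv L p‖ * (r / 2 - dist p c) := hmax
  have hc := hmax' c (Metric.mem_closedBall_self (by positivity))
  rw [dist_self, sub_zero] at hc
  rw [le_div_iff₀ hr]
  by_contra! hcon
  have hpos : 0 < ‖deriv L p‖ * (r / 2 - dist p c) := by nlinarith
  have hs : 0 < r / 2 - dist p c := by
    by_contra! h
    nlinarith [norm_nonneg (deriv L p)]
  have hA : 0 < ‖deriv L p‖ := by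
    by_contra! h
    nlinarith
  set s := (r / 2 - dist p c) / 2 with hsdef
  have hbs : Metric.ball p s ⊆ Metric.ball c r := fun v hv => by
    have := dist_triangle v p c
    rw [Metric.mem_ball] at hv ⊢
    linarith
  refine himg (L p) (Set.Subset.trans (Metric.ball_subset_ball ?_)
    ((ball_subset_image_ball_of_norm_deriv_le (s := s) (by positivity) (hL.mono hbs)
      (norm_pos_iff.1 hA) fun v hv => ?_).trans (Set.image_mono hbs)))
  · have : ‖deriv L p‖ * (r / 2 - dist p c) = 2 * (‖deriv L p‖ * s) := by rw [hsdef]; ring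
    linarith
  · have htri := dist_triangle v p c
    rw [Metric.mem_ball] at hv
    have h1 := hmax' v (by rw [Metric.mem_closedBall]; linarith)
    have h2 : s ≤ r / 2 - dist v c := by linarith
    have h3 : ‖deriv L v‖ * s ≤ 2 * ‖deriv L p‖ * s := by
      calc ‖deriv L v‖ * s ≤ ‖deriv L v‖ * (r / 2 - dist v c) := by gcongr
        _ ≤ _ := h1
        _ = _ := by rw [hsdef]; ring
    exact le_of_mul_le_mul_right h3 (by positivity)

/-! ### Uniform distortion of inverse branches -/

theorem exists_holomorphic_log_on_ball {g : ℂ → ℂ} {w : ℂ} {δ : ℝ} (hδ : 0 < δ)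
    (hg : DifferentiableOn ℂ g (Metric.ball w δ)) (h0 : ∀ v ∈ Metric.ball w δ, g v ≠ 0) :
    ∃ L : ℂ → ℂ, DifferentiableOn ℂ L (Metric.ball w δ) ∧
      ∀ v ∈ Metric.ball w δ, Complex.exp (L v) = g v := by
  have hw := Metric.mem_ball_self (x := w) hδ
  have hdg := hg.deriv Metric.isOpen_ball
  obtain ⟨L, hLw, hL⟩ := (hdg.div hg h0).isExactOn_ball.with_val_at w (Complex.log (g w))
  have hLd : DifferentiableOn ℂ L (Metric.ball w δ) := fun v hv =>
    (hL v hv).differentiableAt.differentiableWithinAt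
  refine ⟨L, hLd, fun v hv => ?_⟩
  have hder : ∀ u ∈ Metric.ball w δ, HasDerivAt (fun u => Complex.exp (-L u) * g u) 0 u := by
    intro u hu
    have h1 := (hL u hu).neg.cexp.mul
      (hg.differentiableAt (Metric.isOpen_ball.mem_nhds hu)).hasDerivAt
    refine h1.congr_deriv ?_
    have := h0 u hu
    rw [Pi.div_apply]
    field_simp
    ring
  have heq := (convex_ball w δ).norm_image_sub_le_of_norm_hasDerivWithin_le (C := 0)
    (fun u hu => (hder u hu).hasDerivWithinAt) (fun u _ => by simp) hw hv
  rw [zero_mul, norm_le_zero_iff, sub_eq_zero] at heq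
  rw [hLw, Complex.exp_neg (Complex.log _), Complex.exp_log (h0 w hw), inv_mul_cancel₀ (h0 w hw),
    Complex.exp_neg, inv_mul_eq_one₀ (Complex.exp_ne_zero _)] at heq
  exact heq

/-- Bloch's theorem applied to `log (φ - a)`. The point is that `ε` depends on `δ` and `η` only,
hence serves all branches at once. -/
theorem norm_sub_le_mul_of_injOn_of_omits {δ η : ℝ} (hδ : 0 < δ) (hη : 0 < η) :
    ∃ ε > 0, ε ≤ δ ∧ ∀ (φ : ℂ → ℂ) (w a p : ℂ), DifferentiableOn ℂ φ (Metric.ball w δ) →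
      Set.InjOn φ (Metric.ball w δ) → (∀ v ∈ Metric.ball w δ, φ v ≠ a) →
      p ∈ Metric.ball w ε → ‖φ w - φ p‖ ≤ η * ‖φ p - a‖ := by
  set C : ℝ := 96 * 7 / (δ / 2) with hC
  have hCpos : 0 < C := by positivity
  refine ⟨min (δ / 2) (min 1 (η / 2) / C), by positivity,
    (min_le_left _ _).trans (by linarith), ?_⟩
  intro φ w a p hφ hinj ha hp
  obtain ⟨L, hL, hexp⟩ := exists_holomorphic_log_on_ball hδ (hφ.sub_const a)
    fun v hv => sub_ne_zero.2 (ha v hv)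
  -- Since `7 > 2π`, such a disc would contain `q` and `q + 2πi`, contradicting injectivity of `φ`.
  have himg : ∀ q, ¬ Metric.ball q 7 ⊆ L '' Metric.ball w δ := by
    intro q hq
    obtain ⟨u, hu, hLu⟩ := hq (Metric.mem_ball_self (by norm_num))
    obtain ⟨v, hv, hLv⟩ := hq (show q + 2 * Real.pi * Complex.I ∈ Metric.ball q 7 by
      rw [mem_ball_iff_norm, add_sub_cancel_left]
      simp only [norm_mul, Complex.norm_ofNat, Complex.norm_real, Complex.norm_I, mul_one,
        Real.norm_eq_abs, abs_of_pos Real.pi_pos]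
      linarith [Real.pi_lt_d2])
    have h1 : φ u = φ v := by
      have := hexp v hv
      rw [hLv, Complex.exp_periodic q, ← hLu, hexp u hu] at this
      exact sub_left_injective this
    rw [← hinj hu hv h1, hLu] at hLv
    simp [Real.pi_ne_zero] at hLv
  have hder : ∀ v ∈ Metric.ball w (δ / 2), ‖deriv L v‖ ≤ C := by
    intro v hv
    have hbs : Metric.ball v (δ / 2) ⊆ Metric.ball w δ := by
      apply Metric.ball_subset_ball'
      rw [Metric.mem_ball] at hv
      linarith
    exact norm_deriv_le_of_not_ball_subset_image (by positivity) (by norm_num) (hL.mono hbs)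
      fun q hq => himg q (hq.trans (Set.image_mono hbs))
  have hsub : Metric.ball w (δ / 2) ⊆ Metric.ball w δ := Metric.ball_subset_ball (by linarith)
  have hw : w ∈ Metric.ball w (δ / 2) := Metric.mem_ball_self (by positivity)
  have hp' : p ∈ Metric.ball w (δ / 2) := Metric.ball_subset_ball (min_le_left _ _) hp
  have hlip := (convex_ball w (δ / 2)).norm_image_sub_le_of_norm_deriv_le
    (fun v hv => hL.differentiableAt (Metric.isOpen_ball.mem_nhds (hsub hv))) hder hp' hw
  have hd : ‖L w - L p‖ ≤ min 1 (η / 2) := by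
    refine hlip.trans ?_
    have : ‖w - p‖ ≤ min 1 (η / 2) / C := by
      rw [← dist_eq_norm, dist_comm]
      exact (Metric.mem_ball.1 hp).le.trans (min_le_right _ _)
    calc C * ‖w - p‖ ≤ C * (min 1 (η / 2) / C) := by gcongr
      _ = _ := by field_simp
  have hkey : φ w - φ p = (φ p - a) * (Complex.exp (L w - L p) - 1) := by
    rw [Complex.exp_sub, hexp w (hsub hw), hexp p (hsub hp')]
    have := sub_ne_zero.2 (ha p (hsub hp'))
    field_simp
    ring
  rw [hkey, norm_mul, mul_comm]
  gcongr
  linarith [Complex.norm_exp_sub_one_le (hd.trans (min_le_left _ _)), hd.trans (min_le_right _ _)]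

/-- Near an evenly covered value `w`, every point has a preimage of `w` at small relative
distance. -/
theorem exists_preimage_near_of_isEvenlyCovered {f : ℂ → ℂ} (hf : Differentiable ℂ f)
    (hconst : ¬ ∃ c, ∀ z, f z = c) {w : ℂ} {I : Type*} [TopologicalSpace I]
    (hw : IsEvenlyCovered f w I) :
    ∃ a : ℂ, ∀ η > 0, ∃ ε > 0, ∀ z, f z ∈ Metric.ball w ε →
      ∃ ζ, f ζ = w ∧ ‖ζ - z‖ ≤ η * ‖z - a‖ := by
  obtain ⟨δ₀, hδ₀, h⟩ := exists_holomorphic_section_of_isEvenlyCovered hf hconst hw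
  obtain ⟨a, ha⟩ : ∃ a, f a ≠ w := by
    by_contra! hc
    exact hconst ⟨w, hc⟩
  refine ⟨a, fun η hη => ?_⟩
  -- With `f a` outside the disc, no branch over it takes the value `a`.
  have hδ : 0 < min δ₀ (dist (f a) w) := lt_min hδ₀ (dist_pos.2 ha)
  obtain ⟨ε, hε, hεδ, hε'⟩ := norm_sub_le_mul_of_injOn_of_omits hδ hη
  have hsub : Metric.ball w (min δ₀ (dist (f a) w)) ⊆ Metric.ball w δ₀ :=
    Metric.ball_subset_ball (min_le_left _ _)
  refine ⟨ε, hε, fun z hz => ?_⟩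
  obtain ⟨φ, hφ, hφz, hfφ⟩ := h z (hsub (Metric.ball_subset_ball hεδ hz))
  refine ⟨φ w, hfφ w (Metric.mem_ball_self hδ₀), ?_⟩
  have := hε' φ w a (f z) (hφ.mono hsub)
    (fun u hu v hv huv => by rw [← hfφ u (hsub hu), huv, hfφ v (hsub hv)])
    (fun v hv hva => by
      have h1 := hfφ v (hsub hv)
      rw [hva] at h1
      rw [Metric.mem_ball, ← h1] at hv
      exact absurd (hv.trans_le (min_le_right _ _)) (lt_irrefl _)) hz
  rwa [hφz] at this

/-! ### A two-constants estimate on a square -/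

/-- If `g` is bounded by `M` on a square centred at `z` and by `ε` on the real axis, which contains
one of its sides, then `|g(z)|⁴ ≤ ε M³`. -/
theorem norm_pow_four_le_of_bound_on_square {g : ℂ → ℂ} {z : ℂ} {M ε : ℝ} (hz : z.im ≠ 0)
    {Ω : Set ℂ} (hg : DifferentiableOn ℂ g Ω)
    (hsq : ∀ u : ℂ, |u.re - z.re| ≤ |z.im| → |u.im - z.im| ≤ |z.im| → u ∈ Ω)
    (hM : ∀ u ∈ Ω, ‖g u‖ ≤ M)
    (hε : ∀ x : ℝ, |x - z.re| ≤ |z.im| → ‖g x‖ ≤ ε) :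
    ‖g z‖ ^ 4 ≤ ε * M ^ 3 := by
  have hM0 : 0 ≤ M := (norm_nonneg _).trans (hM z (hsq z (by simp) (by simp)))
  set d := |z.im| with hd
  have hdpos : 0 < d := abs_pos.2 hz
  let Q : Set ℂ := Set.Ioo (-d) d ×ℂ Set.Ioo (-d) d
  have hcl : closure Q = Set.Icc (-d) d ×ℂ Set.Icc (-d) d := by
    rw [Complex.closure_reProdIm, closure_Ioo (by linarith)]
  have hmem : ∀ u ∈ closure Q, |u.re| ≤ d ∧ |u.im| ≤ d := by
    intro u hu
    rw [hcl, Complex.mem_reProdIm] at hu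
    exact ⟨abs_le.2 hu.1, abs_le.2 hu.2⟩
  have hm0 : ∀ u : ℂ, |u.re| ≤ d → |u.im| ≤ d → z + u ∈ Ω := fun u h1 h2 =>
    hsq _ (by simpa using h1) (by simpa using h2)
  have m1 : ∀ u ∈ closure Q, z + u ∈ Ω := fun u hu => hm0 u (hmem u hu).1 (hmem u hu).2
  have m2 : ∀ u ∈ closure Q, z + -u ∈ Ω := fun u hu =>
    hm0 _ (by simpa using (hmem u hu).1) (by simpa using (hmem u hu).2)
  have m3 : ∀ u ∈ closure Q, z + Complex.I * u ∈ Ω := fun u hu =>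
    hm0 _ (by simpa using (hmem u hu).2) (by simpa using (hmem u hu).1)
  have m4 : ∀ u ∈ closure Q, z + -(Complex.I * u) ∈ Ω := fun u hu =>
    hm0 _ (by simpa using (hmem u hu).2) (by simpa using (hmem u hu).1)
  -- At each boundary point of the square, one of the four quarter turns lands on the side in the
  -- real axis, so one factor is at most `ε`.
  let P : ℂ → ℂ := fun u =>
    g (z + u) * g (z + -u) * g (z + Complex.I * u) * g (z + -(Complex.I * u))
  have hP : DifferentiableOn ℂ P (closure Q) :=
    (((hg.comp (by fun_prop) m1).mul (hg.comp (by fun_prop) m2)).mul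
      (hg.comp (by fun_prop) m3)).mul (hg.comp (by fun_prop) m4)
  have hreal : ∀ u : ℂ, |u.re| ≤ d → u.im = -z.im → ‖g (z + u)‖ ≤ ε := by
    intro u hu hui
    have : z + u = ((z.re + u.re : ℝ) : ℂ) := by
      apply Complex.ext <;> simp [hui]
    rw [this]
    exact hε _ (by simpa using hu)
  have hbound : ∀ u ∈ frontier Q, ‖P u‖ ≤ ε * M ^ 3 := by
    intro u hu
    have huc : u ∈ closure Q := frontier_subset_closure hu
    have hedge : |u.re| = d ∨ |u.im| = d := by
      rw [Complex.frontier_reProdIm, frontier_Ioo (by linarith)] at hu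
      rcases hu with hu | hu
      · have := hu.2
        rcases this with h | h
        · exact Or.inr (by rw [h, abs_neg, abs_of_pos hdpos])
        · exact Or.inr (by rw [h, abs_of_pos hdpos])
      · have := hu.1
        rcases this with h | h
        · exact Or.inl (by rw [h, abs_neg, abs_of_pos hdpos])
        · exact Or.inl (by rw [h, abs_of_pos hdpos])
    obtain ⟨hur, hui⟩ := hmem u huc
    have n1 := hM _ (m1 u huc)
    have n2 := hM _ (m2 u huc)
    have n3 := hM _ (m3 u huc)
    have n4 := hM _ (m4 u huc)
    have hε0 : 0 ≤ ε := (norm_nonneg _).trans (hε z.re (by simpa using hdpos.le))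
    simp only [P, norm_mul]
    rcases hedge with h | h
    · rcases abs_eq_abs.1 h with h | h
      · have := hreal (-(Complex.I * u)) (by simpa using hui) (by simp [h])
        calc _ ≤ M * M * M * ε := by gcongr
          _ = _ := by ring
      · have := hreal (Complex.I * u) (by simpa using hui) (by simp [h])
        calc _ ≤ M * M * ε * M := by gcongr
          _ = _ := by ring
    · rcases abs_eq_abs.1 h with h | h
      · have := hreal (-u) (by simpa using hur) (by simp [h])
        calc _ ≤ M * ε * M * M := by gcongr
          _ = _ := by ring
      · have := hreal u hur h
        calc _ ≤ ε * M * M * M := by gcongr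
          _ = _ := by ring
  have hbdd : Bornology.IsBounded Q :=
    Metric.isBounded_Ioo _ _ |>.reProdIm (Metric.isBounded_Ioo _ _)
  have h0 : (0 : ℂ) ∈ closure Q := subset_closure ⟨by simpa using hdpos, by simpa using hdpos⟩
  have := Complex.norm_le_of_forall_mem_frontier_norm_le hbdd hP.diffContOnCl hbound h0
  calc ‖g z‖ ^ 4 = ‖P 0‖ := by simp [P]; ring
    _ ≤ _ := this

/-! ### Estimates in sectors -/

theorem mem_truncatedSector_iff {σ θ R : ℝ} (hσ : σ = 1 ∨ σ = -1) {z : ℂ} :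
    z ∈ truncatedSector σ θ R ↔ R < σ * z.re ∧ |z.im| < θ * (σ * z.re) := by
  have hσσ : σ * σ = 1 := by rcases hσ with rfl | rfl <;> norm_num
  constructor
  · rintro ⟨x, y, hx, hy, rfl⟩
    simpa [← mul_assoc, hσσ] using ⟨hx, hy⟩
  · rintro ⟨hx, hy⟩
    refine ⟨σ * z.re, z.im, hx, hy, ?_⟩
    rw [← mul_assoc, hσσ, one_mul]
    apply Complex.ext <;> simp

theorem not_isConst_of_mem_escapingSigns {f : ℂ → ℂ} {σ : ℝ} (hσ : σ ∈ escapingSigns f) :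
    ¬ ∃ c, ∀ z, f z = c := by
  rintro ⟨c, hc⟩
  have := hσ.2
  simp only [hc] at this
  exact not_tendsto_const_atTop _ _ this

/-- If a nonsingular value is omitted in a truncated sector, then a whole disc about it is omitted
in a smaller one. -/
theorem exists_sector_omitting_ball {f : ℂ → ℂ} (hf : Differentiable ℂ f)
    (hconst : ¬ ∃ c, ∀ z, f z = c) {w : ℂ} (hw : w ∉ singularValues f) {σ : ℝ}
    (hσ : σ = 1 ∨ σ = -1) (h : OmitsTruncatedSector (f ⁻¹' {w}) σ) :
    ∃ ε > 0, OmitsTruncatedSector (f ⁻¹' Metric.ball w ε) σ := by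
  obtain ⟨θ, hθ, R, hR, hdisj⟩ := h
  have hev := (isLeast_singularValues f).1.2 w hw
  obtain ⟨a, ha⟩ := exists_preimage_near_of_isEvenlyCovered hf hconst hev
  -- Here `‖z - a‖ ≤ (2 + θ) * x`, so `ζ` moves by at most `η * (2 + θ) * x`: at most `x / 2`, and
  -- too little to leave the aperture `θ` from `θ / 2`.
  set η : ℝ := min (1 / 2) (θ / (2 * (1 + θ))) / (2 + θ) with hη
  have hηpos : 0 < η := by positivity
  have hη1 : η * (2 + θ) ≤ 1 / 2 := by
    rw [hη, div_mul_cancel₀ _ (by positivity)]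
    exact min_le_left _ _
  have hη2 : η * (2 + θ) * (1 + θ) ≤ θ / 2 := by
    rw [hη, div_mul_cancel₀ _ (by positivity)]
    calc _ ≤ θ / (2 * (1 + θ)) * (1 + θ) := by
          gcongr
          exact min_le_right _ _
      _ = θ / 2 := by field_simp
  obtain ⟨ε, hε, hε'⟩ := ha η hηpos
  refine ⟨ε, hε, θ / 2, by positivity, max (2 * R) ‖a‖, lt_max_of_lt_left (by positivity), ?_⟩
  rw [Set.disjoint_left]
  intro z hz hzs
  obtain ⟨ζ, hζ, hd⟩ := hε' z hz
  refine Set.disjoint_left.1 hdisj (show ζ ∈ f ⁻¹' {w} from hζ) ?_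
  rw [mem_truncatedSector_iff hσ] at hzs ⊢
  obtain ⟨hx, hy⟩ := hzs
  have hσabs : |σ| = 1 := by rcases hσ with rfl | rfl <;> norm_num
  set x := σ * z.re with hxdef
  have hxR : 2 * R < x := (le_max_left _ _).trans_lt hx
  have hxa : ‖a‖ < x := (le_max_right _ _).trans_lt hx
  have hxpos : 0 < x := by linarith
  have hre : |z.re| = x := by
    have : |x| = |z.re| := by rw [hxdef, abs_mul, hσabs, one_mul]
    rw [← this, abs_of_pos hxpos]
  have hnz : ‖z - a‖ ≤ (2 + θ) * x := by
    have h1 := norm_sub_le z a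
    have h2 := Complex.norm_le_abs_re_add_abs_im z
    rw [hre] at h2
    nlinarith [mul_pos hθ hxpos]
  set e := η * (2 + θ) * x with he
  have hde : ‖ζ - z‖ ≤ e := by
    refine hd.trans ?_
    rw [he, mul_assoc]
    gcongr
  have hre' : |σ * ζ.re - x| ≤ e := by
    have : σ * ζ.re - x = σ * (ζ - z).re := by rw [hxdef, Complex.sub_re]; ring
    rw [this, abs_mul, hσabs, one_mul]
    exact (Complex.abs_re_le_norm _).trans hde
  have him : |ζ.im| ≤ |z.im| + e := by
    have h1 := (Complex.abs_im_le_norm (ζ - z)).trans hde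
    have h2 := abs_sub_abs_le_abs_sub ζ.im z.im
    rw [Complex.sub_im] at h1
    linarith
  have he1 : e ≤ x / 2 := by rw [he]; nlinarith
  have he2 : e * (1 + θ) ≤ θ / 2 * x := by
    calc e * (1 + θ) = η * (2 + θ) * (1 + θ) * x := by rw [he]; ring
      _ ≤ _ := by gcongr
  have hlow : x - e ≤ σ * ζ.re := by linarith [(abs_le.1 hre').1]
  have hlow' : θ * (x - e) ≤ θ * (σ * ζ.re) := by gcongr
  exact ⟨by linarith, by nlinarith⟩

theorem tendsto_inv_sub_of_mem_escapingSigns {f : ℂ → ℂ} {σ : ℝ} (hσ : σ ∈ escapingSigns f)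
    (w : ℂ) {ε : ℝ} (hε : 0 < ε) :
    ∃ X : ℝ, ∀ x : ℝ, X ≤ σ * x → ‖(f x - w)⁻¹‖ ≤ ε := by
  obtain ⟨X, hX⟩ := eventually_atTop.1 (hσ.2.eventually_ge_atTop (‖w‖ + ε⁻¹))
  have hσσ : σ * σ = 1 := by rcases hσ.1 with rfl | rfl <;> norm_num
  refine ⟨X, fun x hx => ?_⟩
  have h1 := hX _ hx
  rw [← mul_assoc, hσσ, one_mul] at h1
  have h2 := norm_sub_norm_le (f x) w
  rw [norm_inv]
  exact inv_le_of_inv_le₀ hε (by linarith)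

/-- If a disc is omitted in a truncated sector about a ray along which `f` tends to `∞`, then `f`
tends to `∞` in a smaller sector. -/
theorem sectorCondition_of_omits_ball {f : ℂ → ℂ} (hf : Differentiable ℂ f) {σ : ℝ}
    (hσ : σ ∈ escapingSigns f) {w : ℂ} {ε : ℝ} (hε : 0 < ε)
    (h : OmitsTruncatedSector (f ⁻¹' Metric.ball w ε) σ) : SectorCondition f σ := by
  obtain ⟨θ, hθ, R, hR, hdisj⟩ := h
  have hσabs : |σ| = 1 := by rcases hσ.1 with rfl | rfl <;> norm_num
  set Ω := truncatedSector σ θ R with hΩdef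
  have hfar : ∀ u ∈ Ω, ε ≤ ‖f u - w‖ := by
    intro u hu
    by_contra! hcon
    exact Set.disjoint_left.1 hdisj (show u ∈ f ⁻¹' Metric.ball w ε by
      simpa [dist_eq_norm] using hcon) hu
  let g : ℂ → ℂ := fun u => (f u - w)⁻¹
  have hg : DifferentiableOn ℂ g Ω := fun u hu =>
    ((hf u).sub_const w).inv (norm_pos_iff.1 (hε.trans_le (hfar u hu)))
      |>.differentiableWithinAt
  have hgM : ∀ u ∈ Ω, ‖g u‖ ≤ ε⁻¹ := fun u hu => by
    rw [norm_inv]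
    exact inv_anti₀ hε (hfar u hu)
  filter_upwards [eventually_gt_atTop 0] with T hT
  set κ : ℝ := (T + ‖w‖ + 1)⁻¹ with hκ
  have hκpos : 0 < κ := by positivity
  -- With `M = ε⁻¹`, the bound `κ ^ 4 * ε ^ 3` on the axis yields `‖g z‖ ^ 4 ≤ κ ^ 4`; the bound `κ`
  -- serves real `z`.
  obtain ⟨X, hX⟩ := tendsto_inv_sub_of_mem_escapingSigns hσ w
    (ε := min κ (κ ^ 4 * ε ^ 3)) (by positivity)
  -- In the square of half-side `|y|` about `z`, `σ * re` exceeds `x / 2` and `|im| ≤ 2 * |y| < θ *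
  -- x / 2`, so the square lies in `Ω`.
  set θ' : ℝ := min (1 / 2) (θ / 4) with hθ'
  refine ⟨θ', by positivity, max (2 * R) (2 * |X|), lt_max_of_lt_left (by positivity), ?_⟩
  intro x y hx hy
  have hx1 : 2 * R < x := (le_max_left _ _).trans_lt hx
  have hx2 : 2 * |X| < x := (le_max_right _ _).trans_lt hx
  have hxpos : 0 < x := by linarith
  have hy1 : |y| < x / 2 := hy.trans_le (by
    calc θ' * x ≤ 1 / 2 * x := by gcongr; exact min_le_left _ _
      _ = x / 2 := by ring)
  have hy2 : |y| < θ / 4 * x := hy.trans_le (by gcongr; exact min_le_right _ _)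
  set z : ℂ := ((σ * x : ℝ) : ℂ) + Complex.I * (y : ℂ) with hz
  have hzre : z.re = σ * x := by simp [hz]
  have hzim : z.im = y := by simp [hz]
  have hσσ : σ * σ = 1 := by rcases hσ.1 with rfl | rfl <;> norm_num
  have hnear : ∀ t : ℝ, |t - z.re| ≤ |z.im| → x / 2 < σ * t := by
    intro t ht
    rw [hzre, hzim] at ht
    have h1 : σ * t - x = σ * (t - σ * x) := by linear_combination x * hσσ
    have h2 : |σ * t - x| ≤ |y| := by rwa [h1, abs_mul, hσabs, one_mul]
    linarith [(abs_le.1 h2).1]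
  have hreal : ∀ t : ℝ, |t - z.re| ≤ |z.im| → ‖g t‖ ≤ min κ (κ ^ 4 * ε ^ 3) := fun t ht =>
    hX t (by linarith [hnear t ht, le_abs_self X])
  have hgz : ‖g z‖ ≤ κ := by
    by_cases hy0 : y = 0
    · have h1 := hreal z.re (by simp)
      have h2 : ((z.re : ℝ) : ℂ) = z := by
        apply Complex.ext <;> simp [hzim, hy0]
      rw [h2] at h1
      exact h1.trans (min_le_left _ _)
    · have h4 := norm_pow_four_le_of_bound_on_square (g := g) (z := z) (by rwa [hzim]) hg
        (fun u hur hui => by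
          rw [mem_truncatedSector_iff hσ.1]
          have h1 := hnear u.re hur
          rw [hzim] at hui
          have h2 := abs_sub_abs_le_abs_sub u.im y
          refine ⟨by linarith, ?_⟩
          have h3 : θ * (x / 2) < θ * (σ * u.re) := by gcongr
          linarith)
        hgM hreal
      refine le_of_pow_le_pow_left₀ (n := 4) (by norm_num) hκpos.le (h4.trans ?_)
      calc min κ (κ ^ 4 * ε ^ 3) * ε⁻¹ ^ 3 ≤ κ ^ 4 * ε ^ 3 * ε⁻¹ ^ 3 := by
            gcongr
            exact min_le_right _ _
        _ = κ ^ 4 := by field_simp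
  have hzΩ : z ∈ Ω := by
    rw [hΩdef, mem_truncatedSector_iff hσ.1, hzre, hzim, ← mul_assoc, hσσ, one_mul]
    exact ⟨by linarith, by nlinarith⟩
  have hpos : 0 < ‖f z - w‖ := hε.trans_le (hfar z hzΩ)
  have h5 : T + ‖w‖ + 1 ≤ ‖f z - w‖ := by
    have : ‖f z - w‖⁻¹ ≤ (T + ‖w‖ + 1)⁻¹ := by simpa [g] using hgz
    exact (inv_le_inv₀ hpos (by positivity)).1 this
  linarith [norm_sub_le (f z) w]

/-! ### The unbounded component, and the equivalence -/

theorem isPreconnected_compl_closedBall_zero (r : ℝ) :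
    IsPreconnected (Metric.closedBall (0 : ℂ) r)ᶜ := by
  have himg : (Metric.closedBall (0 : ℂ) r)ᶜ =
      (fun q : ℝ × ℝ => (q.1 : ℂ) * Complex.exp (q.2 * Complex.I)) '' Set.Ioi r ×ˢ Set.univ := by
    ext z
    simp only [Set.mem_compl_iff, mem_closedBall_zero_iff, not_le]
    constructor
    · intro hz
      exact ⟨(‖z‖, z.arg), ⟨hz, Set.mem_univ _⟩, Complex.norm_mul_exp_arg_mul_I z⟩
    · rintro ⟨q, ⟨hq, -⟩, rfl⟩
      have hq : r < q.1 := hq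
      rw [norm_mul, Complex.norm_exp_ofReal_mul_I, mul_one, Complex.norm_real]
      exact hq.trans_le (le_abs_self _)
  rw [himg]
  exact (isPreconnected_Ioi.prod isPreconnected_univ).image _
    (by fun_prop : Continuous _).continuousOn

theorem nonempty_unboundedComponent {S : Set ℂ} (hS : Bornology.IsBounded S) :
    (unboundedComponent S).Nonempty := by
  obtain ⟨r, hr⟩ := hS.subset_closedBall 0
  have hsub : (Metric.closedBall (0 : ℂ) r)ᶜ ⊆ Sᶜ := Set.compl_subset_compl.2 hr
  have hunb : ¬ Bornology.IsBounded (Metric.closedBall (0 : ℂ) r)ᶜ := fun hb =>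
    NormedSpace.unbounded_univ ℂ ℂ
      (Set.union_compl_self (Metric.closedBall (0 : ℂ) r) ▸ Metric.isBounded_closedBall.union hb)
  have hne : (Metric.closedBall (0 : ℂ) r)ᶜ.Nonempty := by
    by_contra! he
    exact hunb (he ▸ Bornology.isBounded_empty)
  obtain ⟨w, hw⟩ := hne
  exact ⟨w, hsub hw, fun hb => hunb (hb.subset
    ((isPreconnected_compl_closedBall_zero r).subset_connectedComponentIn hw hsub))⟩

theorem mainTheorem9 (f : ℂ → ℂ) (hf : IsRealClassB f) (σ : ℝ) (hσ : σ ∈ escapingSigns f) :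
    List.TFAE [
      SectorCondition f σ,
      ∀ K : Set ℂ, IsCompact K → OmitsTruncatedSector (f ⁻¹' K) σ,
      ∃ w ∈ unboundedComponent (singularValues f), OmitsTruncatedSector (f ⁻¹' {w}) σ] := by
  tfae_have 1 → 2 := by
    intro h K hK
    obtain ⟨r, hr⟩ := hK.isBounded.subset_closedBall 0
    obtain ⟨T, hT, hrT⟩ := (h.and (eventually_ge_atTop r)).exists
    obtain ⟨θ, hθ, R, hR, hb⟩ := hT
    refine ⟨θ, hθ, R, hR, Set.disjoint_left.2 ?_⟩
    rintro _ hzK ⟨x, y, hx, hy, rfl⟩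
    have := mem_closedBall_zero_iff.1 (hr hzK)
    linarith [hb x y hx hy]
  tfae_have 2 → 3 := fun h =>
    (nonempty_unboundedComponent hf.bounded).imp fun w hw => ⟨hw, h _ isCompact_singleton⟩
  tfae_have 3 → 1 := by
    rintro ⟨w, hw, hom⟩
    obtain ⟨ε, hε, h⟩ := exists_sector_omitting_ball hf.entire
      (not_isConst_of_mem_escapingSigns hσ) hw.1 hσ.1 hom
    exact sectorCondition_of_omits_ball hf.entire hσ hε h
  tfae_finish
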